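/- Let $0<T<\infty$, let $\Lambda\subset\mathbb R$ and $\Omega\subset\mathbb R^n$ be open and let $F:\Lambda\times\Omega\times[0,T]\to\mathbb R^n$. Let $\mathbb R^n$ carry the norm $\|x\|_n=\sum_j|x_j|$ and let the space $\mathcal L(\mathbb R^n)$ of real $n\times n$ matrices carry the norm $\|A\|_{n\times n}=\max_i\sum_j|a_{ij}|$. Let $G[0,T]$ be the Banach space of regulated functions $[0,T]\to\mathbb R^n$ (those having a left limit at every point of $(0,T]$ and a right limit at every point of $[0,T)$) with the supremum norm $\|\cdot\|_\infty$, and let $B(x_0,\rho)$ be its closed ball with centre $x_0$ and radius $\rho$. For $U:[0,s]\times[0,s]\to\mathbb R^n$, $\int_0^sDU(\tau,t)$ denotes the Kurzweil integral: the $I\in\mathbb R^n$ such that for every $\varepsilon>0$ there is $\delta:[0,s]\to(0,\infty)$ with $\big\|\sum_j[U(\tau_j,t_j)-U(\tau_j,t_{j-1})]-I\big\|_n<\varepsilon$ for all $0=t_0\le t_1\le\dots\le t_\nu=s$ and $\tau_j\in[t_{j-1},t_j]\subset(\tau_j-\delta(\tau_j),\tau_j+\delta(\tau_j))$. For $X=\mathbb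 R^n$ or $X=\mathcal L(\mathbb R^n)$, a nondecreasing $h:[0,T]\to\mathbb R$ and an increasing continuous $\omega:[0,\infty)\to[0,\infty)$ with $\omega(0)=0$, let $\mathcal F(h,\omega;X)$ be the set of all $H:\Omega\times[0,T]\to X$ such that, for all $x,y\in\Omega$ and $t,s\in[0,T]$, $$\|H(x,t)-H(x,s)\|_X\le|h(t)-h(s)|,\qquad \|H(x,t)-H(x,s)-H(y,t)+H(y,s)\|_X\le\omega(\|x-y\|_n)\,|h(t)-h(s)|.$$ Assume: 1. there are $h,\omega$ as above such that $F(\lambda,\cdot,\cdot)\in\mathcal F(h,\omega;\mathbb R^n)$ for all $\lambda\in\Lambda$; 2. $x_0\in G[0,T]$ satisfies, for every $\lambda\in\Lambda$, $x_0(0)=x_0(T)$, $x_0(s)\in\Omega$ and $x_0(s)=x_0(0)+\int_0^sDF(\lambda,x_0(\tau),t)$ for $s\in[0,T]$; and $\rho>0$ is such that $x(t)\in\Omega$ for all $x\in B(x_0,\rho)$ and $t\in[0,T]$; 3. there is a nondecreasing $\gamma:[0,T]\to\mathbb R$ such that for every $\varepsilon>0$ there is $\delta>0$ with $$\|F(\lambda_1,x,t)-F(\lambda_2,x,t)-F(\lambda_1,x,s)+F(\lambda_2,x,s)\|_n\le\varepsilon\,|\gamma(t)-\gamma(s)|$$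 for all $x\in\Omega$, $t,s\in[0,T]$ and $\lambda_1,\lambda_2\in\Lambda$ with $|\lambda_1-\lambda_2|<\delta$; 4. for every $(\lambda,x,t)\in\Lambda\times\Omega\times[0,T]$ the function $F(\lambda,\cdot,t)$ has a derivative $F'_x(\lambda,x,t)\in\mathcal L(\mathbb R^n)$ at $x$, which is continuous in $x\in\Omega$ for fixed $(\lambda,t)$, and there are a nondecreasing $\widetilde h:[0,T]\to[0,\infty)$ and an increasing continuous $\widetilde\omega:[0,\infty)\to[0,\infty)$ with $\widetilde\omega(0)=0$ such that $F'_x(\lambda,\cdot,\cdot)\in\mathcal F(\widetilde h,\widetilde\omega;\mathcal L(\mathbb R^n))$ for all $\lambda\in\Lambda$; 5. condition 3 holds with $F'_x$ in place of $F$, the norm $\|\cdot\|_{n\times n}$ in place of $\|\cdot\|_n$, and some nondecreasing $\widetilde\gamma$ in place of $\gamma$. For $\lambda\in\Lambda$ and $x\in B(x_0,\rho)$ put $\Phi(\lambda,x)(s)=x(T)+\int_0^sDF(\lambda,x(\tau),t)$, $s\in[0,T]$. Let $\lambda_0\in\Lambda$ and suppose that $(x_0,\lambda_0)$ is a bifurcation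 point of the equation $x=\Phi(\lambda,x)$, that is, $(x_0,\lambda_0)$ is a solution of it and every neighbourhood of $(x_0,\lambda_0)$ in $B(x_0,\rho)\times\Lambda$ contains a solution $(x,\lambda)$ with $x\neq x_0$. Then there is $q\in G[0,T]$ such that the equation $$z(s)-z(T)-\int_0^sD[F'_x(\lambda_0,x_0(\tau),t)\,z(\tau)]=q(s)\quad\text{for } s\in[0,T]$$ has no solution $z\in G[0,T]$, and the corresponding homogeneous equation (with $q=0$) has at least one nontrivial solution $z\in G[0,T]$. -/

import Mathlib

open Set Filter Topology

attribute [local instance] Matrix.linftyOpNormedAddCommGroup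

/-- `ℝⁿ` with the norm `‖x‖ = ∑ j, |x j|`. Square matrices carry the maximal absolute row sum as
their norm (the local instance above). -/
abbrev Rn (n : ℕ) : Type := PiLp 1 (fun _ : Fin n => ℝ)

/-- The linear operator on `ℝⁿ` represented by a matrix. -/
noncomputable def matCLM {n : ℕ} (A : Matrix (Fin n) (Fin n) ℝ) : Rn n →L[ℝ] Rn n :=
  LinearMap.toContinuousLinearMap (Matrix.toLpLin 1 1 A)

/-! ### Regulated functions

A function on `[a, b]` is represented by a function on `ℝ` of which only the values on `[a, b]`
matter. -/

/-- The set `G([a, b]; X)` of regulated functions. -/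
def regulated (a b : ℝ) (X : Type*) [TopologicalSpace X] : Set (ℝ → X) :=
  {x | (∀ t ∈ Ioc a b, ∃ l, Tendsto x (𝓝[<] t) (𝓝 l)) ∧
       (∀ t ∈ Ico a b, ∃ l, Tendsto x (𝓝[>] t) (𝓝 l))}

/-- The supremum norm on `[0, T]` (regulated functions are bounded). -/
noncomputable def supNorm {X : Type*} [Norm X] (T : ℝ) (x : ℝ → X) : ℝ :=
  ⨆ t : Icc (0 : ℝ) T, ‖x t‖

/-- The closed ball `B(x₀, ρ)` in `G([0, T]; X)`. -/
def regBall {X : Type*} [NormedAddCommGroup X] (T : ℝ) (x₀ : ℝ → X) (ρ : ℝ) : Set (ℝ → X) :=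
  {x | x ∈ regulated 0 T X ∧ supNorm T (fun t => x t - x₀ t) ≤ ρ}

/-! ### The Kurzweil integral -/

/-- A tagged partition `a = t₀ ≤ t₁ ≤ ⋯ ≤ t_ν = b` with tags `tag j ∈ [t_j, t_{j+1}]`, `j < ν`. -/
structure TaggedPart (a b : ℝ) where
  ν : ℕ
  pt : ℕ → ℝ
  tag : ℕ → ℝ
  pt_zero : pt 0 = a
  pt_last : pt ν = b
  pt_le : ∀ j < ν, pt j ≤ pt (j + 1)
  tag_mem : ∀ j < ν, tag j ∈ Icc (pt j) (pt (j + 1))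

/-- `P` is `δ`-fine. -/
def TaggedPart.IsFine {a b : ℝ} (P : TaggedPart a b) (δ : ℝ → ℝ) : Prop :=
  ∀ j < P.ν, Icc (P.pt j) (P.pt (j + 1)) ⊆
    Ioo (P.tag j - δ (P.tag j)) (P.tag j + δ (P.tag j))

/-- The sum `∑ j, [U(τ_j, t_j) - U(τ_j, t_{j-1})]`. -/
noncomputable def TaggedPart.kSum {X : Type*} [AddCommGroup X] {a b : ℝ} (P : TaggedPart a b)
    (U : ℝ → ℝ → X) : X :=
  ∑ j ∈ Finset.range P.ν, (U (P.tag j) (P.pt (j + 1)) - U (P.tag j) (P.pt j))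

/-- `I` is the Kurzweil integral of `U = U(τ, t)` over `[a, b]`, where `a ≤ b`
(for `a = b` all the sums are `0`, so `I = 0`). -/
def HasKurzweilIntegral {X : Type*} [NormedAddCommGroup X] (U : ℝ → ℝ → X) (a b : ℝ) (I : X) :
    Prop :=
  ∀ ε > 0, ∃ δ : ℝ → ℝ, (∀ s ∈ Icc a b, 0 < δ s) ∧
    ∀ P : TaggedPart a b, P.IsFine δ → ‖P.kSum U - I‖ < ε

/-- `U` is Kurzweil integrable over `[a, b]`. -/
def KurzweilIntegrable {X : Type*} [NormedAddCommGroup X] (U : ℝ → ℝ → X) (a b : ℝ) : Prop :=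
  ∃ I, HasKurzweilIntegral U a b I

open Classical in
/-- The value `∫_a^b DU(τ, t)`, for `a ≤ b`. -/
noncomputable def kurzweilIntegral {X : Type*} [NormedAddCommGroup X] (U : ℝ → ℝ → X) (a b : ℝ) :
    X :=
  if h : KurzweilIntegrable U a b then Classical.choose h else 0

/-! ### The class of right-hand sides -/

/-- `ω : [0, ∞) → [0, ∞)` is increasing and continuous with `ω(0) = 0`. -/
def IsModulus (ω : ℝ → ℝ) : Prop :=
  StrictMonoOn ω (Ici 0) ∧ ContinuousOn ω (Ici 0) ∧ ω 0 = 0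

/-- The class `𝓕(Ω × [a, b], h, ω; X)`. -/
def classF {E X : Type*} [NormedAddCommGroup E] [NormedAddCommGroup X] (Ω : Set E) (a b : ℝ)
    (h ω : ℝ → ℝ) : Set (E → ℝ → X) :=
  {F | (∀ x ∈ Ω, ∀ t₁ ∈ Icc a b, ∀ t₂ ∈ Icc a b, ‖F x t₂ - F x t₁‖ ≤ |h t₂ - h t₁|) ∧
       (∀ x ∈ Ω, ∀ y ∈ Ω, ∀ t₁ ∈ Icc a b, ∀ t₂ ∈ Icc a b,
         ‖F x t₂ - F x t₁ - F y t₂ + F y t₁‖ ≤ ω ‖x - y‖ * |h t₂ - h t₁|)}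

/-- `F(λ, ·, ·) ∈ 𝓕(Ω × [0, T], h, ω)` for all `λ ∈ Λ`, with `h`, `ω` independent of `λ`. -/
def FieldCondition {n : ℕ} (Λ : Set ℝ) (Ω : Set (Rn n)) (T : ℝ) (F : ℝ → Rn n → ℝ → Rn n) :
    Prop :=
  ∃ h ω : ℝ → ℝ, MonotoneOn h (Icc 0 T) ∧ IsModulus ω ∧ ∀ lam ∈ Λ, F lam ∈ classF Ω 0 T h ω

/-- `DF(λ, x, t)` is the (matrix of the) derivative of `F(λ, ·, t)` at `x`, it is continuous in `x`
and `DF(λ, ·, ·) ∈ 𝓕(Ω × [0, T], h, ω; 𝓛(ℝⁿ))` for all `λ ∈ Λ`, with `h`, `ω` independent of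
`λ`. -/
def DerivCondition {n : ℕ} (Λ : Set ℝ) (Ω : Set (Rn n)) (T : ℝ) (F : ℝ → Rn n → ℝ → Rn n)
    (DF : ℝ → Rn n → ℝ → Matrix (Fin n) (Fin n) ℝ) : Prop :=
  (∀ lam ∈ Λ, ∀ x ∈ Ω, ∀ t ∈ Icc 0 T,
    HasFDerivAt (fun y => F lam y t) (matCLM (DF lam x t)) x) ∧
  (∀ lam ∈ Λ, ∀ t ∈ Icc 0 T, ContinuousOn (fun x => DF lam x t) Ω) ∧
  ∃ h ω : ℝ → ℝ, MonotoneOn h (Icc 0 T) ∧ (∀ t ∈ Icc 0 T, 0 ≤ h t) ∧ IsModulus ω ∧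
    ∀ lam ∈ Λ, DF lam ∈ classF Ω 0 T h ω

/-- Continuous dependence on the parameter: there is a nondecreasing `γ` such that for every
`ε > 0` there is `δ > 0` with
`‖F(λ₁,x,t) - F(λ₂,x,t) - F(λ₁,x,s) + F(λ₂,x,s)‖ ≤ ε |γ(t) - γ(s)|` whenever
`|λ₁ - λ₂| < δ`. -/
def ParamCondition {E X : Type*} [NormedAddCommGroup X] (Λ : Set ℝ) (Ω : Set E) (T : ℝ)
    (F : ℝ → E → ℝ → X) : Prop :=
  ∃ γ : ℝ → ℝ, MonotoneOn γ (Icc 0 T) ∧ ∀ ε > 0, ∃ δ > 0,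
    ∀ x ∈ Ω, ∀ t ∈ Icc 0 T, ∀ s ∈ Icc 0 T, ∀ lam₁ ∈ Λ, ∀ lam₂ ∈ Λ, |lam₁ - lam₂| < δ →
      ‖F lam₁ x t - F lam₂ x t - F lam₁ x s + F lam₂ x s‖ ≤ ε * |γ t - γ s|

/-! ### The periodic problem, the operator `Φ` and bifurcation points -/

/-- `(x, λ)` solves the periodic problem `dx/dτ = DF(λ, x, t)`, `x(0) = x(T)`. -/
def IsPeriodicSolution {n : ℕ} (Λ : Set ℝ) (Ω : Set (Rn n)) (T : ℝ) (F : ℝ → Rn n → ℝ → Rn n)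
    (x : ℝ → Rn n) (lam : ℝ) : Prop :=
  x ∈ regulated 0 T (Rn n) ∧ lam ∈ Λ ∧
  (∀ s ∈ Icc 0 T, x s ∈ Ω ∧ KurzweilIntegrable (fun τ t => F lam (x τ) t) 0 s ∧
    x s = x 0 + kurzweilIntegral (fun τ t => F lam (x τ) t) 0 s) ∧
  x 0 = x T

/-- `Φ(λ, x)(s) = x(T) + ∫_0^s DF(λ, x(τ), t)`. -/
noncomputable def Phi {n : ℕ} (T : ℝ) (F : ℝ → Rn n → ℝ → Rn n) (lam : ℝ) (x : ℝ → Rn n) (s : ℝ) :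
    Rn n :=
  x T + kurzweilIntegral (fun τ t => F lam (x τ) t) 0 s

/-- `(x, λ) ∈ B(x₀, ρ) × Λ` solves `x = Φ(λ, x)` (the integrals in `Φ(λ, x)` exist). -/
def IsOperatorSolution {n : ℕ} (Λ : Set ℝ) (T : ℝ) (F : ℝ → Rn n → ℝ → Rn n) (x₀ : ℝ → Rn n)
    (ρ : ℝ) (x : ℝ → Rn n) (lam : ℝ) : Prop :=
  x ∈ regBall T x₀ ρ ∧ lam ∈ Λ ∧
  ∀ s ∈ Icc 0 T, KurzweilIntegrable (fun τ t => F lam (x τ) t) 0 s ∧ x s = Phi T F lam x s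

/-- `(x₀, λ₀)` is a bifurcation point of `x = Φ(λ, x)`: it is a solution and every neighbourhood of
it in `B(x₀, ρ) × Λ` contains a solution `(x, λ)` with `x ≠ x₀`. -/
def IsBifurcationPoint {n : ℕ} (Λ : Set ℝ) (T : ℝ) (F : ℝ → Rn n → ℝ → Rn n) (ρ : ℝ)
    (x₀ : ℝ → Rn n) (lam₀ : ℝ) : Prop :=
  IsOperatorSolution Λ T F x₀ ρ x₀ lam₀ ∧
  ∀ ε > 0, ∃ (x : ℝ → Rn n) (lam : ℝ), IsOperatorSolution Λ T F x₀ ρ x lam ∧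
    supNorm T (fun t => x t - x₀ t) < ε ∧ |lam - lam₀| < ε ∧ ∃ t ∈ Icc 0 T, x t ≠ x₀ t

/-- `z ∈ G[0, T]` solves `z(s) - z(T) - ∫_0^s D[A(x₀(τ), t) z(τ)] = q(s)` for `s ∈ [0, T]`. -/
def IsLinearSolution {n : ℕ} (T : ℝ) (A : Rn n → ℝ → Matrix (Fin n) (Fin n) ℝ) (x₀ : ℝ → Rn n)
    (q z : ℝ → Rn n) : Prop :=
  z ∈ regulated 0 T (Rn n) ∧
  ∀ s ∈ Icc 0 T, KurzweilIntegrable (fun τ t => matCLM (A (x₀ τ) t) (z τ)) 0 s ∧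
    z s - z T - kurzweilIntegral (fun τ t => matCLM (A (x₀ τ) t) (z τ)) 0 s = q s

/-! Because `x₀` solves the problem for every parameter, the equations for `x₀` and for a nearby
solution `x_k` can be subtracted at the same `λ_k`. Dividing by `m_k = ‖x_k - x₀‖` gives normalised
`Z_k` with `Z_k(s) - Z_k(T) = ∫_0^s DW_k`. By the mean value inequality
(`norm_increment_sub_linear_le`) the increments of `W_k` in `t` are those of `F'_x(λ₀, x₀(τ), t)
Z_k(τ)`, up to a small multiple of the increments of one monotone `g`. So the increments of `Z_k`
are eventually dominated by those of a multiple of `g`, and a Helly-type theorem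
(`exists_uniform_limit`) yields a uniform limit `z` along an ultrafilter. It is nonzero by the
normalisation and solves the homogeneous equation by `HasKurzweilIntegral.of_approx`.

If the inhomogeneous equation were solvable for every `q`, solving repeatedly, starting from `q =
z`, would give an infinite Jordan chain. Riesz's lemma excludes this (`not_exists_jordan_chain`),
since `z - q` depends compactly on `z`. The equation is treated as a linear relation between `z` and
`q`, so no existence theorem for Kurzweil integrals is needed: every integral exists by assumption
or as a limit. -/

/-! ### Tagged partitions -/

namespace TaggedPart

/-- The partition of a degenerate interval into no subintervals. -/
def trivial (a : ℝ) : TaggedPart a a where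
  ν := 0
  pt _ := a
  tag _ := a
  pt_zero := rfl
  pt_last := rfl
  pt_le j hj := by simp at hj
  tag_mem j hj := by simp at hj

theorem isFine_trivial (a : ℝ) (δ : ℝ → ℝ) : (trivial a).IsFine δ :=
  fun _ hj => absurd hj (Nat.not_lt_zero _)

/-- A partition of `[a, b]` extended by the interval `[b, c]` with tag `τ`. -/
def snoc {a b : ℝ} (P : TaggedPart a b) (c τ : ℝ) (hbτ : b ≤ τ) (hτc : τ ≤ c) :
    TaggedPart a c where
  ν := P.ν + 1
  pt j := if j ≤ P.ν then P.pt j else c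
  tag j := if j < P.ν then P.tag j else τ
  pt_zero := by simp [P.pt_zero]
  pt_last := by simp
  pt_le j hj := by
    rcases Nat.lt_succ_iff_lt_or_eq.1 hj with h | rfl
    · simpa [h.le, Nat.succ_le_of_lt h] using P.pt_le j h
    · simpa [P.pt_last] using hbτ.trans hτc
  tag_mem j hj := by
    rcases Nat.lt_succ_iff_lt_or_eq.1 hj with h | rfl
    · simpa [h, h.le, Nat.succ_le_of_lt h] using P.tag_mem j h
    · simpa [P.pt_last] using ⟨hbτ, hτc⟩

theorem IsFine.snoc {a b : ℝ} {P : TaggedPart a b} {δ : ℝ → ℝ} (hP : P.IsFine δ) {c τ : ℝ}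
    (hbτ : b ≤ τ) (hτc : τ ≤ c) (h : Icc b c ⊆ Ioo (τ - δ τ) (τ + δ τ)) :
    (P.snoc c τ hbτ hτc).IsFine δ := by
  intro j hj
  rcases Nat.lt_succ_iff_lt_or_eq.1 hj with hj | rfl
  · simpa [TaggedPart.snoc, hj, hj.le, Nat.succ_le_of_lt hj] using hP j hj
  · simpa [TaggedPart.snoc, P.pt_last] using h

theorem IsFine.mono {a b : ℝ} {P : TaggedPart a b} {δ δ' : ℝ → ℝ} (hP : P.IsFine δ)
    (h : ∀ s, δ s ≤ δ' s) : P.IsFine δ' := fun j hj =>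
  (hP j hj).trans (Ioo_subset_Ioo (by linarith [h (P.tag j)]) (by linarith [h (P.tag j)]))

theorem pt_mem {a b : ℝ} (P : TaggedPart a b) {j : ℕ} (hj : j ≤ P.ν) : P.pt j ∈ Icc a b := by
  constructor
  · induction j with
    | zero => exact P.pt_zero.ge
    | succ j ih => exact (ih (Nat.le_of_succ_le hj)).trans (P.pt_le j hj)
  · have : ∀ k, ∀ i, i + k = P.ν → P.pt i ≤ b := by
      intro k
      induction k with
      | zero => intro i hi; rw [show i = P.ν by omega, P.pt_last]
      | succ k ih =>
        intro i hi
        exact (P.pt_le i (by omega)).trans (ih (i + 1) (by omega))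
    exact this (P.ν - j) j (by omega)

theorem tag_mem_Icc {a b : ℝ} (P : TaggedPart a b) {j : ℕ} (hj : j < P.ν) :
    P.tag j ∈ Icc a b :=
  ⟨(P.pt_mem hj.le).1.trans (P.tag_mem j hj).1, (P.tag_mem j hj).2.trans (P.pt_mem hj).2⟩

variable {X : Type*} [NormedAddCommGroup X] {a b : ℝ}

theorem kSum_snoc (P : TaggedPart a b) (U : ℝ → ℝ → X) {c τ : ℝ} (hbτ : b ≤ τ) (hτc : τ ≤ c) :
    (P.snoc c τ hbτ hτc).kSum U = P.kSum U + (U τ c - U τ b) := by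
  unfold kSum
  rw [show (P.snoc c τ hbτ hτc).ν = P.ν + 1 from rfl, Finset.sum_range_succ]
  congr 1
  · refine Finset.sum_congr rfl fun j hj => ?_
    have hj := Finset.mem_range.1 hj
    simp [snoc, hj, hj.le, Nat.succ_le_of_lt hj]
  · simp [snoc, P.pt_last]

theorem kSum_add (P : TaggedPart a b) (U V : ℝ → ℝ → X) :
    P.kSum (fun τ t => U τ t + V τ t) = P.kSum U + P.kSum V := by
  unfold kSum
  rw [← Finset.sum_add_distrib]
  exact Finset.sum_congr rfl fun j _ => add_sub_add_comm _ _ _ _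

theorem kSum_sub (P : TaggedPart a b) (U V : ℝ → ℝ → X) :
    P.kSum (fun τ t => U τ t - V τ t) = P.kSum U - P.kSum V := by
  unfold kSum
  rw [← Finset.sum_sub_distrib]
  exact Finset.sum_congr rfl fun j _ => sub_sub_sub_comm _ _ _ _

theorem kSum_smul [NormedSpace ℝ X] (P : TaggedPart a b) (c : ℝ) (U : ℝ → ℝ → X) :
    P.kSum (fun τ t => c • U τ t) = c • P.kSum U := by
  unfold kSum
  rw [Finset.smul_sum]
  exact Finset.sum_congr rfl fun j _ => (smul_sub _ _ _).symm

theorem norm_kSum_le (P : TaggedPart a b) {U : ℝ → ℝ → X} {g : ℝ → ℝ}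
    (hU : ∀ τ ∈ Icc a b, ∀ s ∈ Icc a b, ∀ t ∈ Icc a b, s ≤ t → ‖U τ t - U τ s‖ ≤ g t - g s) :
    ‖P.kSum U‖ ≤ g b - g a := by
  calc ‖P.kSum U‖ ≤ ∑ j ∈ Finset.range P.ν, (g (P.pt (j + 1)) - g (P.pt j)) := by
        refine norm_sum_le_of_le _ fun j hj => ?_
        have hj := Finset.mem_range.1 hj
        exact hU _ (P.tag_mem_Icc hj) _ (P.pt_mem hj.le) _ (P.pt_mem hj) (P.pt_le j hj)
    _ = g b - g a := by
        rw [Finset.sum_range_sub (fun j => g (P.pt j)), P.pt_zero, P.pt_last]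

/-- Cousin's lemma, in the form that every fine partition of `[a, c]` extends to a fine partition
of `[a, b]`, together with a bound for the change of the integral sum. -/
theorem IsFine.exists_extension {c : ℝ} (hcb : c ≤ b) {δ : ℝ → ℝ}
    (hδ : ∀ s ∈ Icc c b, 0 < δ s) {P : TaggedPart a c} (hP : P.IsFine δ) {U : ℝ → ℝ → X}
    {g : ℝ → ℝ}
    (hU : ∀ τ ∈ Icc c b, ∀ s ∈ Icc c b, ∀ t ∈ Icc c b, s ≤ t → ‖U τ t - U τ s‖ ≤ g t - g s) :
    ∃ Q : TaggedPart a b, Q.IsFine δ ∧ ‖Q.kSum U - P.kSum U‖ ≤ g b - g c := by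
  set S : Set ℝ := {s | s ∈ Icc c b ∧
    ∃ Q : TaggedPart a s, Q.IsFine δ ∧ ‖Q.kSum U - P.kSum U‖ ≤ g s - g c} with hS
  -- One more interval `[s, r]` with tag `τ` is appended. Taking for `τ` the supremum `m` of `S`
  -- then reaches past `m` unless `m = b`.
  have step : ∀ s ∈ S, ∀ τ ∈ Icc s b, ∀ r ∈ Icc τ b, τ - δ τ < s → r < τ + δ τ → r ∈ S := by
    rintro s ⟨hs, Q, hQ, hQU⟩ τ hτ r hr h1 h2
    have hτc : τ ∈ Icc c b := ⟨hs.1.trans hτ.1, hτ.2⟩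
    have hrc : r ∈ Icc c b := ⟨hτc.1.trans hr.1, hr.2⟩
    refine ⟨hrc, Q.snoc r τ hτ.1 hr.1, hQ.snoc _ _ fun x hx =>
      ⟨h1.trans_le hx.1, hx.2.trans_lt h2⟩, ?_⟩
    rw [kSum_snoc, add_sub_right_comm]
    have := hU τ hτc s hs r hrc (hτ.1.trans hr.1)
    linarith [norm_add_le (Q.kSum U - P.kSum U) (U τ r - U τ s)]
  have hcS : c ∈ S := ⟨⟨le_rfl, hcb⟩, P, hP, by simp⟩
  have hbdd : BddAbove S := ⟨b, fun s hs => hs.1.2⟩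
  set m := sSup S with hm
  have hcm : c ≤ m := le_csSup hbdd hcS
  have hmb : m ≤ b := csSup_le ⟨c, hcS⟩ fun s hs => hs.1.2
  have hδm := hδ m ⟨hcm, hmb⟩
  obtain ⟨s, hsS, hs⟩ := exists_lt_of_lt_csSup ⟨c, hcS⟩ (show m - δ m < sSup S by linarith)
  have hsm : s ≤ m := le_csSup hbdd hsS
  have hr : min b (m + δ m / 2) ∈ S :=
    step s hsS m ⟨hsm, hmb⟩ _ ⟨le_min hmb (by linarith), min_le_left _ _⟩ hs
      ((min_le_right _ _).trans_lt (by linarith))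
  have hrb : min b (m + δ m / 2) = b := by
    rcases min_choice b (m + δ m / 2) with h | h
    · exact h
    · have := le_csSup hbdd hr
      rw [h] at this
      linarith
  rw [hrb] at hr
  exact hr.2

theorem exists_isFine (hab : a ≤ b) {δ : ℝ → ℝ} (hδ : ∀ s ∈ Icc a b, 0 < δ s) :
    ∃ P : TaggedPart a b, P.IsFine δ := by
  obtain ⟨Q, hQ, -⟩ := (isFine_trivial a δ).exists_extension hab hδ
    (U := fun _ _ => (0 : ℝ)) (g := fun _ => 0) (by simp)
  exact ⟨Q, hQ⟩

end TaggedPart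

/-! ### Properties of the Kurzweil integral -/

namespace HasKurzweilIntegral

variable {X : Type*} [NormedAddCommGroup X] {a b : ℝ} {U V : ℝ → ℝ → X} {I J : X}

theorem unique (hab : a ≤ b) (hI : HasKurzweilIntegral U a b I)
    (hJ : HasKurzweilIntegral U a b J) : I = J := by
  by_contra hne
  have hpos : 0 < ‖I - J‖ := norm_pos_iff.2 (sub_ne_zero.2 hne)
  obtain ⟨δ, hδ, h⟩ := hI (‖I - J‖ / 2) (by linarith)
  obtain ⟨δ', hδ', h'⟩ := hJ (‖I - J‖ / 2) (by linarith)
  obtain ⟨P, hP⟩ := TaggedPart.exists_isFine hab (δ := fun s => min (δ s) (δ' s))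
    fun s hs => lt_min (hδ s hs) (hδ' s hs)
  have h1 := h P (hP.mono fun s => min_le_left _ _)
  have h2 := h' P (hP.mono fun s => min_le_right _ _)
  have h3 := norm_sub_le (P.kSum U - J) (P.kSum U - I)
  rw [sub_sub_sub_cancel_left] at h3
  linarith

theorem kurzweilIntegral_eq (hab : a ≤ b) (h : HasKurzweilIntegral U a b I) :
    kurzweilIntegral U a b = I := by
  have hi : KurzweilIntegrable U a b := ⟨I, h⟩
  rw [kurzweilIntegral, dif_pos hi]
  exact (Classical.choose_spec hi).unique hab h

theorem add (hU : HasKurzweilIntegral U a b I) (hV : HasKurzweilIntegral V a b J) :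
    HasKurzweilIntegral (fun τ t => U τ t + V τ t) a b (I + J) := by
  intro ε hε
  obtain ⟨δ, hδ, h⟩ := hU (ε / 2) (by linarith)
  obtain ⟨δ', hδ', h'⟩ := hV (ε / 2) (by linarith)
  refine ⟨fun s => min (δ s) (δ' s), fun s hs => lt_min (hδ s hs) (hδ' s hs), fun P hP => ?_⟩
  have h1 := h P (hP.mono fun s => min_le_left _ _)
  have h2 := h' P (hP.mono fun s => min_le_right _ _)
  rw [P.kSum_add, add_sub_add_comm]
  linarith [norm_add_le (P.kSum U - I) (P.kSum V - J)]

theorem const_smul [NormedSpace ℝ X] (c : ℝ) (hU : HasKurzweilIntegral U a b I) :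
    HasKurzweilIntegral (fun τ t => c • U τ t) a b (c • I) := by
  intro ε hε
  have hc : 0 < |c| + 1 := by positivity
  obtain ⟨δ, hδ, h⟩ := hU (ε / (|c| + 1)) (by positivity)
  refine ⟨δ, hδ, fun P hP => ?_⟩
  rw [P.kSum_smul, ← smul_sub, norm_smul, Real.norm_eq_abs]
  have := h P hP
  rw [lt_div_iff₀ hc] at this
  nlinarith [norm_nonneg (P.kSum U - I)]

theorem sub [NormedSpace ℝ X] (hU : HasKurzweilIntegral U a b I)
    (hV : HasKurzweilIntegral V a b J) :
    HasKurzweilIntegral (fun τ t => U τ t - V τ t) a b (I - J) := by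
  simpa [sub_eq_add_neg] using hU.add (hV.const_smul (-1))

/-- The increments of the indefinite integral are controlled by those of the integrand. -/
theorem norm_sub_le {c : ℝ} (hac : a ≤ c) (hcb : c ≤ b) (hI : HasKurzweilIntegral U a c I)
    (hJ : HasKurzweilIntegral U a b J) {g : ℝ → ℝ}
    (hU : ∀ τ ∈ Icc a b, ∀ s ∈ Icc a b, ∀ t ∈ Icc a b, s ≤ t → ‖U τ t - U τ s‖ ≤ g t - g s) :
    ‖J - I‖ ≤ g b - g c := by
  refine le_of_forall_pos_le_add fun ε hε => ?_
  obtain ⟨δ, hδ, h⟩ := hI (ε / 2) (by linarith)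
  obtain ⟨δ', hδ', h'⟩ := hJ (ε / 2) (by linarith)
  -- `P` is fine for both gauges on `[a, c]`, and its extension `Q` to `[a, b]` for the second; the
  -- two sums differ only by the part over `[c, b]`.
  obtain ⟨P, hP⟩ := TaggedPart.exists_isFine hac (δ := fun s => min (δ s) (δ' s))
    fun s hs => lt_min (hδ s hs) (hδ' s ⟨hs.1, hs.2.trans hcb⟩)
  have hsub : Icc c b ⊆ Icc a b := Icc_subset_Icc_left hac
  obtain ⟨Q, hQ, hQU⟩ := (hP.mono fun s => min_le_right _ _).exists_extension hcb
    (fun s hs => hδ' s (hsub hs))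
    (fun τ hτ s hs t ht => hU τ (hsub hτ) s (hsub hs) t (hsub ht))
  have h1 := h P (hP.mono fun s => min_le_left _ _)
  have h2 := h' Q hQ
  have h3 : J - I = (Q.kSum U - P.kSum U) + (P.kSum U - I) - (Q.kSum U - J) := by abel
  rw [h3]
  have h4 := _root_.norm_sub_le ((Q.kSum U - P.kSum U) + (P.kSum U - I)) (Q.kSum U - J)
  linarith [norm_add_le (Q.kSum U - P.kSum U) (P.kSum U - I)]

theorem refl (U : ℝ → ℝ → X) (a : ℝ) : HasKurzweilIntegral U a a 0 := by
  refine fun ε hε => ⟨fun _ => 1, fun _ _ => one_pos, fun P _ => ?_⟩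
  have := P.norm_kSum_le (U := U) (g := fun _ => 0) (by simp +contextual)
  rw [sub_zero]
  exact this.trans_lt (by simpa using hε)

theorem norm_le (hab : a ≤ b) (hI : HasKurzweilIntegral U a b I) {g : ℝ → ℝ}
    (hU : ∀ τ ∈ Icc a b, ∀ s ∈ Icc a b, ∀ t ∈ Icc a b, s ≤ t → ‖U τ t - U τ s‖ ≤ g t - g s) :
    ‖I‖ ≤ g b - g a := by
  simpa using (refl U a).norm_sub_le le_rfl hab hI hU

/-- Passage to the limit under the integral sign. -/
theorem of_approx (hab : a ≤ b) {g : ℝ → ℝ} (hg : MonotoneOn g (Icc a b))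
    (h : ∀ ε > 0, ∃ V J, HasKurzweilIntegral V a b J ∧ ‖J - I‖ ≤ ε ∧
      ∀ τ ∈ Icc a b, ∀ s ∈ Icc a b, ∀ t ∈ Icc a b, s ≤ t →
        ‖(V τ t - V τ s) - (U τ t - U τ s)‖ ≤ ε * (g t - g s)) :
    HasKurzweilIntegral U a b I := by
  intro ε hε
  have hD : 0 ≤ g b - g a := sub_nonneg.2 (hg ⟨le_rfl, hab⟩ ⟨hab, le_rfl⟩ hab)
  -- Three errors add up to `ε`: the sum for `V` against `J`, `J` against `I` (each at most `η`),
  -- and `V` against `U` (at most `η * (g b - g a)`).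
  set η := ε / (g b - g a + 2) with hη
  have hη0 : 0 < η := by positivity
  have hηε : η * (g b - g a) + η + η = ε := by
    rw [hη]
    field_simp
    ring
  obtain ⟨V, J, hV, hJI, hVU⟩ := h η hη0
  obtain ⟨δ, hδ, hP⟩ := hV η hη0
  refine ⟨δ, hδ, fun P hPf => ?_⟩
  have h1 := hP P hPf
  have h2 : ‖P.kSum V - P.kSum U‖ ≤ η * g b - η * g a := by
    rw [← P.kSum_sub]
    refine P.norm_kSum_le (g := fun t => η * g t) fun τ hτ s hs t ht hst => ?_
    rw [sub_sub_sub_comm, ← mul_sub]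
    exact hVU τ hτ s hs t ht hst
  have h3 : P.kSum U - I = (P.kSum V - J) + (J - I) - (P.kSum V - P.kSum U) := by abel
  rw [h3]
  have h4 := _root_.norm_sub_le ((P.kSum V - J) + (J - I)) (P.kSum V - P.kSum U)
  linarith [norm_add_le (P.kSum V - J) (J - I)]

end HasKurzweilIntegral

theorem KurzweilIntegrable.hasKurzweilIntegral {X : Type*} [NormedAddCommGroup X] {a b : ℝ}
    {U : ℝ → ℝ → X} (h : KurzweilIntegrable U a b) :
    HasKurzweilIntegral U a b (kurzweilIntegral U a b) := by
  rw [kurzweilIntegral, dif_pos h]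
  exact Classical.choose_spec h

/-! ### Regulated functions -/

section Regulated

variable {X : Type*} [NormedAddCommGroup X] {a b : ℝ}

/-- One-sided limits bound `x` on each side of a point, the value at the point itself is one more
number, and compactness of `[a, b]` makes the local bounds global. -/
theorem exists_norm_le_of_mem_regulated {x : ℝ → X} (hx : x ∈ regulated a b X) :
    ∃ C, ∀ t ∈ Icc a b, ‖x t‖ ≤ C := by
  have hloc : ∀ {t l} {s : Set ℝ}, Tendsto x (𝓝[s] t) (𝓝 l) →
      ∃ C, ∀ᶠ r in 𝓝 t, r ∈ s → ‖x r‖ ≤ C := fun {t l s} h =>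
    ⟨‖l‖ + 1, eventually_nhdsWithin_iff.1
      ((h.norm.eventually (gt_mem_nhds (lt_add_one ‖l‖))).mono fun _ hr => le_of_lt hr)⟩
  refine isCompact_Icc.induction_on (p := fun s => ∃ C, ∀ t ∈ s, ‖x t‖ ≤ C) ⟨0, by simp⟩
    (fun s t hst ⟨C, hC⟩ => ⟨C, fun r hr => hC r (hst hr)⟩) ?_ ?_
  · rintro s t ⟨C, hC⟩ ⟨C', hC'⟩
    exact ⟨max C C', fun r hr => hr.elim (fun h => (hC r h).trans (le_max_left _ _))
      (fun h => (hC' r h).trans (le_max_right _ _))⟩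
  · intro t ht
    have hl : ∃ C, ∀ᶠ r in 𝓝 t, r ∈ Icc a b → r < t → ‖x r‖ ≤ C := by
      rcases ht.1.eq_or_lt with rfl | hat
      · exact ⟨0, Eventually.of_forall fun r hr hr' => absurd hr.1 hr'.not_ge⟩
      · obtain ⟨l, h⟩ := hx.1 t ⟨hat, ht.2⟩
        obtain ⟨C, hC⟩ := hloc h
        exact ⟨C, hC.mono fun r hr _ hr' => hr hr'⟩
    have hr : ∃ C, ∀ᶠ r in 𝓝 t, r ∈ Icc a b → t < r → ‖x r‖ ≤ C := by
      rcases ht.2.eq_or_lt with rfl | htb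
      · exact ⟨0, Eventually.of_forall fun r hr hr' => absurd hr.2 hr'.not_ge⟩
      · obtain ⟨l, h⟩ := hx.2 t ⟨ht.1, htb⟩
        obtain ⟨C, hC⟩ := hloc h
        exact ⟨C, hC.mono fun r hr _ hr' => hr hr'⟩
    obtain ⟨C, hC⟩ := hl
    obtain ⟨C', hC'⟩ := hr
    refine ⟨_, inter_mem_nhdsWithin _ (hC.and hC'), max (max C C') ‖x t‖, ?_⟩
    rintro r ⟨hrI, h1, h2⟩
    rcases lt_trichotomy r t with h | rfl | h
    · exact (h1 hrI h).trans ((le_max_left _ _).trans (le_max_left _ _))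
    · exact le_max_right _ _
    · exact (h2 hrI h).trans ((le_max_right _ _).trans (le_max_left _ _))

theorem add_mem_regulated {x y : ℝ → X} (hx : x ∈ regulated a b X) (hy : y ∈ regulated a b X) :
    (fun t => x t + y t) ∈ regulated a b X := by
  constructor
  · intro t ht
    obtain ⟨l, hl⟩ := hx.1 t ht
    obtain ⟨m, hm⟩ := hy.1 t ht
    exact ⟨l + m, hl.add hm⟩
  · intro t ht
    obtain ⟨l, hl⟩ := hx.2 t ht
    obtain ⟨m, hm⟩ := hy.2 t ht
    exact ⟨l + m, hl.add hm⟩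

theorem const_mem_regulated (c : X) : (fun _ => c) ∈ regulated a b X :=
  ⟨fun _ _ => ⟨c, tendsto_const_nhds⟩, fun _ _ => ⟨c, tendsto_const_nhds⟩⟩

theorem smul_mem_regulated [NormedSpace ℝ X] {x : ℝ → X} (c : ℝ) (hx : x ∈ regulated a b X) :
    (fun t => c • x t) ∈ regulated a b X := by
  constructor
  · intro t ht
    obtain ⟨l, hl⟩ := hx.1 t ht
    exact ⟨c • l, hl.const_smul c⟩
  · intro t ht
    obtain ⟨l, hl⟩ := hx.2 t ht
    exact ⟨c • l, hl.const_smul c⟩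

theorem sub_mem_regulated [NormedSpace ℝ X] {x y : ℝ → X} (hx : x ∈ regulated a b X)
    (hy : y ∈ regulated a b X) : (fun t => x t - y t) ∈ regulated a b X := by
  simpa [sub_eq_add_neg] using add_mem_regulated hx (smul_mem_regulated (-1) hy)

theorem norm_le_supNorm {T t : ℝ} {x : ℝ → X} (hx : x ∈ regulated 0 T X) (ht : t ∈ Icc 0 T) :
    ‖x t‖ ≤ supNorm T x := by
  obtain ⟨C, hC⟩ := exists_norm_le_of_mem_regulated hx
  exact le_ciSup (f := fun t : Icc (0 : ℝ) T => ‖x t‖) ⟨C, by rintro _ ⟨s, rfl⟩; exact hC s s.2⟩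
    ⟨t, ht⟩

theorem norm_sub_le_abs {f : ℝ → X} {g : ℝ → ℝ}
    (hf : ∀ s ∈ Icc a b, ∀ t ∈ Icc a b, s ≤ t → ‖f t - f s‖ ≤ g t - g s)
    {s t : ℝ} (hs : s ∈ Icc a b) (ht : t ∈ Icc a b) : ‖f t - f s‖ ≤ |g t - g s| := by
  rcases le_total s t with h | h
  · exact (hf s hs t ht h).trans (le_abs_self _)
  · rw [norm_sub_rev, abs_sub_comm]
    exact (hf t ht s hs h).trans (le_abs_self _)

/-- A monotone function has one-sided limits, and the Cauchy property passes from `g` to `f`. -/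
theorem mem_regulated_of_norm_sub_le [CompleteSpace X] (hab : a ≤ b) {f : ℝ → X} {g : ℝ → ℝ}
    (hg : MonotoneOn g (Icc a b))
    (hf : ∀ s ∈ Icc a b, ∀ t ∈ Icc a b, s ≤ t → ‖f t - f s‖ ≤ g t - g s) :
    f ∈ regulated a b X := by
  -- Extending `g` by constants makes it monotone on all of `ℝ`.
  set G : ℝ → ℝ := fun t => g (projIcc a b hab t) with hG
  have hGm : Monotone G := fun s t hst => hg (projIcc a b hab s).2 (projIcc a b hab t).2
    (monotone_projIcc hab hst)
  have key : ∀ {l : Filter ℝ} [l.NeBot] {c : ℝ}, Tendsto G l (𝓝 c) → (∀ᶠ s in l, s ∈ Icc a b) →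
      ∃ y, Tendsto f l (𝓝 y) := by
    intro l _ c hc hl
    refine cauchy_map_iff_exists_tendsto.1 (Metric.cauchy_iff.2 ⟨inferInstance, fun ε hε => ?_⟩)
    obtain ⟨s, hs, hsε⟩ := (Metric.cauchy_iff.1 hc.cauchy_map).2 ε hε
    refine ⟨f '' (G ⁻¹' s ∩ Icc a b), image_mem_map (inter_mem hs hl), ?_⟩
    rintro _ ⟨p, ⟨hp, hpI⟩, rfl⟩ _ ⟨q, ⟨hq, hqI⟩, rfl⟩
    have h1 := hsε _ hp _ hq
    rw [Real.dist_eq] at h1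
    simp only [hG, projIcc_of_mem hab hpI, projIcc_of_mem hab hqI] at h1
    rw [dist_eq_norm]
    exact (norm_sub_le_abs hf hqI hpI).trans_lt h1
  constructor
  · intro t ht
    exact key (hGm.tendsto_leftLim t) (mem_of_superset (Ioo_mem_nhdsLT ht.1)
      fun s hs => ⟨hs.1.le, hs.2.le.trans ht.2⟩)
  · intro t ht
    exact key (hGm.tendsto_rightLim t) (mem_of_superset (Ioo_mem_nhdsGT ht.2)
      fun s hs => ⟨ht.1.trans hs.1.le, hs.2.le⟩)

/-- A bounded sequence of functions whose increments are dominated by those of one monotone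
function is relatively compact for uniform convergence. -/
theorem exists_uniform_limit [ProperSpace X] (u : Ultrafilter ℕ) {f : ℕ → ℝ → X} {g : ℝ → ℝ}
    {C : ℝ} (hab : a ≤ b) (hg : MonotoneOn g (Icc a b))
    (hf : ∀ᶠ k in (u : Filter ℕ), ∀ s ∈ Icc a b, ∀ t ∈ Icc a b, s ≤ t →
      ‖f k t - f k s‖ ≤ g t - g s)
    (hC : ∀ᶠ k in (u : Filter ℕ), ∀ t ∈ Icc a b, ‖f k t‖ ≤ C) :
    ∃ z : ℝ → X, (∀ s ∈ Icc a b, ∀ t ∈ Icc a b, s ≤ t → ‖z t - z s‖ ≤ g t - g s) ∧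
      ∀ ε > 0, ∀ᶠ k in (u : Filter ℕ), ∀ t ∈ Icc a b, ‖f k t - z t‖ ≤ ε := by
  have hlim : ∀ t, ∃ l, t ∈ Icc a b → Tendsto (fun k => f k t) u (𝓝 l) := by
    intro t
    by_cases ht : t ∈ Icc a b
    · obtain ⟨l, -, hl⟩ := (isCompact_closedBall (0 : X) C).ultrafilter_le_nhds'
        (u.map fun k => f k t) (hC.mono fun k hk => by simpa using hk t ht)
      exact ⟨l, fun _ => hl⟩
    · exact ⟨0, fun h => absurd h ht⟩
  choose z hz using hlim
  have hzg : ∀ s ∈ Icc a b, ∀ t ∈ Icc a b, s ≤ t → ‖z t - z s‖ ≤ g t - g s :=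
    fun s hs t ht hst => le_of_tendsto ((hz t ht).sub (hz s hs)).norm
      (hf.mono fun k hk => hk s hs t ht hst)
  refine ⟨z, hzg, fun ε hε => ?_⟩
  -- Distances are measured by `g` instead of `t`, so jumps do no harm: finitely many points `p y`
  -- suffice for every `g t` to be within `ε / 3` of some `g (p y)`.
  have htb : TotallyBounded (g '' Icc a b) := by
    refine (isCompact_Icc (a := g a) (b := g b)).totallyBounded.subset ?_
    rintro _ ⟨t, ht, rfl⟩
    exact ⟨hg ⟨le_rfl, hab⟩ ht ht.1, hg ht ⟨hab, le_rfl⟩ ht.2⟩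
  obtain ⟨N, hN, hNfin, hcov⟩ := Metric.finite_approx_of_totallyBounded htb (ε / 3) (by linarith)
  have hN' : ∀ y ∈ N, ∃ p ∈ Icc a b, g p = y := fun y hy => hN hy
  choose! p hpI hpg using hN'
  have hev : ∀ᶠ k in (u : Filter ℕ), ∀ y ∈ N, ‖f k (p y) - z (p y)‖ < ε / 3 := by
    refine (eventually_all_finite hNfin).2 fun y hy => ?_
    have := (hz (p y) (hpI y hy)).eventually (Metric.ball_mem_nhds _ (show 0 < ε / 3 by linarith))
    simpa [dist_eq_norm] using this
  filter_upwards [hf, hev] with k hk hkN t ht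
  obtain ⟨y, hy, hty⟩ := mem_iUnion₂.1 (hcov ⟨t, ht, rfl⟩)
  rw [Metric.mem_ball, Real.dist_eq, ← hpg y hy] at hty
  have h1 := norm_sub_le_abs hk (hpI y hy) ht
  have h2 := norm_sub_le_abs hzg (hpI y hy) ht
  have h3 := hkN y hy
  have h4 : f k t - z t = (f k t - f k (p y)) + (f k (p y) - z (p y)) - (z t - z (p y)) := by abel
  rw [h4]
  have h5 := norm_sub_le ((f k t - f k (p y)) + (f k (p y) - z (p y))) (z t - z (p y))
  linarith [norm_add_le (f k t - f k (p y)) (f k (p y) - z (p y))]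

end Regulated

/-! ### A Riesz argument for linear relations -/

/-- A form of the Fredholm alternative for a single-valued linear relation `S` in which `z - q`
depends compactly on `z` for `(z, q) ∈ S`: there is no infinite Jordan chain at `0`. -/
theorem not_exists_jordan_chain {E : Type*} [NormedAddCommGroup E] [NormedSpace ℝ E]
    (S : Submodule ℝ (E × E)) (hS : ∀ q, ((0 : E), q) ∈ S → q = 0)
    (hcomp : ∀ v q : ℕ → E, (∀ k, (v k, q k) ∈ S) → (∀ k, ‖v k‖ ≤ 1) →
      ∃ j k, j < k ∧ ‖(v k - q k) - (v j - q j)‖ < 1 / 2)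
    (u : ℕ → E) (hu : u 0 ≠ 0) (hu0 : (u 0, (0 : E)) ∈ S) (huS : ∀ k, (u (k + 1), u k) ∈ S) :
    False := by
  set V : ℕ → Submodule ℝ E := fun k => Submodule.span ℝ (u '' Iio k) with hV
  have hVmono : Monotone V := fun j k hjk =>
    Submodule.span_mono (image_mono (Iio_subset_Iio hjk))
  have huV : ∀ {j k}, j < k → u j ∈ V k := fun h => Submodule.subset_span ⟨_, h, rfl⟩
  -- The relation lowers the filtration `V` by one step, since it sends `u (k + 1)` to `u k` and `u
  -- 0` to `0`.
  have hVS : ∀ k, ∀ v ∈ V (k + 1), ∃ q ∈ V k, (v, q) ∈ S := by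
    intro k v hv
    induction hv using Submodule.span_induction with
    | mem x hx =>
      obtain ⟨j, hj, rfl⟩ := hx
      cases j with
      | zero => exact ⟨0, zero_mem _, hu0⟩
      | succ j => exact ⟨u j, huV (by simpa using hj), huS j⟩
    | zero => exact ⟨0, zero_mem _, S.zero_mem⟩
    | add x y _ _ hx hy =>
      obtain ⟨p, hp, hpS⟩ := hx
      obtain ⟨q, hq, hqS⟩ := hy
      exact ⟨p + q, add_mem hp hq, S.add_mem hpS hqS⟩
    | smul c x _ hx =>
      obtain ⟨p, hp, hpS⟩ := hx
      exact ⟨c • p, (V k).smul_mem c hp, S.smul_mem c hpS⟩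
  -- If `u (k + 1)` lay in `V (k + 1)`, its unique partner `u k` would lie in `V k`.
  have hnot : ∀ k, u k ∉ V k := by
    intro k
    induction k with
    | zero => simpa [hV] using hu
    | succ k ih =>
      intro h
      obtain ⟨q, hq, hqS⟩ := hVS k _ h
      have h0 : ((0 : E), q - u k) ∈ S := by simpa using S.sub_mem hqS (huS k)
      exact ih (sub_eq_zero.1 (hS _ h0) ▸ hq)
  -- Riesz's lemma: normalise `u k - w`, where `w ∈ V k` is within twice the distance from `u k` to
  -- `V k`.
  have hriesz : ∀ k, ∃ v ∈ V (k + 1), ‖v‖ ≤ 1 ∧ ∀ y ∈ V k, 1 / 2 ≤ ‖v - y‖ := by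
    intro k
    have : FiniteDimensional ℝ (V k) :=
      FiniteDimensional.span_of_finite ℝ ((finite_Iio k).image u)
    have hcl : IsClosed (V k : Set E) := (V k).closed_of_finiteDimensional
    have hne : (V k : Set E).Nonempty := ⟨0, zero_mem _⟩
    have hd : 0 < Metric.infDist (u k) (V k) := (hcl.notMem_iff_infDist_pos hne).1 (hnot k)
    obtain ⟨w, hw, hwd⟩ := (Metric.infDist_lt_iff hne).1
      (show Metric.infDist (u k) (V k) < 2 * Metric.infDist (u k) (V k) by linarith)
    rw [dist_eq_norm] at hwd
    set c := ‖u k - w‖ with hc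
    have hc0 : 0 < c := hd.trans_le (by
      simpa [dist_eq_norm] using Metric.infDist_le_dist_of_mem (x := u k) hw)
    refine ⟨c⁻¹ • (u k - w), (V (k + 1)).smul_mem _ (sub_mem (huV k.lt_succ_self)
      (hVmono k.le_succ hw)), ?_, fun y hy => ?_⟩
    · rw [norm_smul, norm_inv, Real.norm_of_nonneg hc0.le, inv_mul_cancel₀ hc0.ne']
    · have h1 : c⁻¹ • (u k - w) - y = c⁻¹ • (u k - (w + c • y)) := by
        rw [← sub_sub, smul_sub c⁻¹ (u k - w), smul_smul, inv_mul_cancel₀ hc0.ne', one_smul]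
      have h2 : Metric.infDist (u k) (V k) ≤ ‖u k - (w + c • y)‖ := by
        rw [← dist_eq_norm]
        exact Metric.infDist_le_dist_of_mem (add_mem hw ((V k).smul_mem c hy))
      rw [h1, norm_smul, norm_inv, Real.norm_of_nonneg hc0.le, inv_mul_eq_div, le_div_iff₀ hc0]
      linarith
  choose v hvV hv1 hvd using hriesz
  choose q hqV hqS using fun k => hVS k (v k) (hvV k)
  obtain ⟨j, k, hjk, h⟩ := hcomp v q hqS hv1
  refine h.not_ge ?_
  -- For `j < k` the vectors `q k`, `v j` and `q j` all lie in `V k`, so the difference is `v k`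
  -- minus an element of `V k`.
  rw [sub_sub]
  exact hvd k _ (add_mem (hqV k) (sub_mem (hVmono hjk (hvV j)) (hVmono hjk.le (hqV j))))

/-! ### Matrices as operators -/

section Matrices

variable {n : ℕ}

theorem matCLM_sub (A B : Matrix (Fin n) (Fin n) ℝ) : matCLM (A - B) = matCLM A - matCLM B := by
  simp [matCLM]

/-- The row-sum norm is not the operator norm for `ℓ¹`. Each of the `n` rows contributes at most
`‖A‖ * ‖v‖`, whence the factor `n`. -/
theorem norm_matCLM_le (A : Matrix (Fin n) (Fin n) ℝ) : ‖matCLM A‖ ≤ n * ‖A‖ := by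
  refine ContinuousLinearMap.opNorm_le_bound _ (by positivity) fun v => ?_
  have hentry : ∀ i j, ‖A i j‖ ≤ ‖A‖ := by
    intro i j
    rw [← coe_nnnorm, ← coe_nnnorm, NNReal.coe_le_coe, Matrix.linfty_opNNNorm_def]
    exact (Finset.single_le_sum (f := fun j => ‖A i j‖₊) (fun _ _ => zero_le)
      (Finset.mem_univ j)).trans
      (Finset.le_sup (f := fun i => ∑ j, ‖A i j‖₊) (Finset.mem_univ i))
  have hrow : ∀ i, ‖(matCLM A v) i‖ ≤ ‖A‖ * ‖v‖ := by
    intro i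
    have : (matCLM A v) i = ∑ j, A i j * v j := by
      simp [matCLM, Matrix.toLpLin, Matrix.mulVec, dotProduct]
    rw [this, PiLp.norm_eq_of_L1, Finset.mul_sum]
    refine norm_sum_le_of_le _ fun j _ => ?_
    rw [norm_mul]
    exact mul_le_mul_of_nonneg_right (hentry i j) (norm_nonneg _)
  rw [PiLp.norm_eq_of_L1 (matCLM A v)]
  calc ∑ i, ‖(matCLM A v) i‖ ≤ ∑ _i : Fin n, ‖A‖ * ‖v‖ := Finset.sum_le_sum fun i _ => hrow i
    _ = n * ‖A‖ * ‖v‖ := by simp [mul_assoc]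

theorem norm_matCLM_apply_le (A : Matrix (Fin n) (Fin n) ℝ) (v : Rn n) :
    ‖matCLM A v‖ ≤ n * ‖A‖ * ‖v‖ :=
  (matCLM A).le_of_opNorm_le (norm_matCLM_le A) v

end Matrices

/-! ### The linearized equation -/

section Linear

variable {n : ℕ} {T : ℝ} {A : Rn n → ℝ → Matrix (Fin n) (Fin n) ℝ} {x₀ : ℝ → Rn n}

/-- In this form linearity in `(z, q)` and passage to the limit follow from the rules for
`HasKurzweilIntegral`. -/
theorem isLinearSolution_iff {q z : ℝ → Rn n} :
    IsLinearSolution T A x₀ q z ↔ z ∈ regulated 0 T (Rn n) ∧ ∀ s ∈ Icc 0 T,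
      HasKurzweilIntegral (fun τ t => matCLM (A (x₀ τ) t) (z τ)) 0 s (z s - z T - q s) := by
  refine and_congr_right fun _ => forall₂_congr fun s hs => ⟨fun h => ?_, fun h => ⟨⟨_, h⟩, ?_⟩⟩
  · rw [← h.2, sub_sub_cancel]
    exact h.1.hasKurzweilIntegral
  · rw [h.kurzweilIntegral_eq hs.1, sub_sub_cancel]

theorem norm_linear_increment_le {h : ℝ → ℝ}
    (hA : ∀ τ ∈ Icc 0 T, ∀ s ∈ Icc 0 T, ∀ t ∈ Icc 0 T, s ≤ t →
      ‖A (x₀ τ) t - A (x₀ τ) s‖ ≤ h t - h s)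
    {z : ℝ → Rn n} {C : ℝ} (hz : ∀ t ∈ Icc 0 T, ‖z t‖ ≤ C) :
    ∀ τ ∈ Icc 0 T, ∀ s ∈ Icc 0 T, ∀ t ∈ Icc 0 T, s ≤ t →
      ‖matCLM (A (x₀ τ) t) (z τ) - matCLM (A (x₀ τ) s) (z τ)‖ ≤ n * C * h t - n * C * h s := by
  intro τ hτ s hs t ht hst
  rw [← sub_apply, ← matCLM_sub, ← mul_sub]
  refine (norm_matCLM_apply_le _ _).trans ?_
  have h1 := hA τ hτ s hs t ht hst
  have h2 := hz τ hτ
  have h3 := norm_nonneg (A (x₀ τ) t - A (x₀ τ) s)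
  calc (n : ℝ) * ‖A (x₀ τ) t - A (x₀ τ) s‖ * ‖z τ‖ ≤ n * (h t - h s) * C := by
        gcongr
        exact mul_nonneg n.cast_nonneg (h3.trans h1)
    _ = n * C * (h t - h s) := by ring

variable (T A x₀) in
/-- The pairs `(z, q)` of bounded functions on `[0, T]` for which `z` solves the linear equation
with right-hand side `q`. -/
def linearRelation : Submodule ℝ
    (lp (fun _ : Icc (0 : ℝ) T => Rn n) ⊤ × lp (fun _ : Icc (0 : ℝ) T => Rn n) ⊤) where
  carrier := {p | ∃ z q : ℝ → Rn n, (∀ t : Icc (0 : ℝ) T, z t = p.1 t) ∧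
    (∀ t : Icc (0 : ℝ) T, q t = p.2 t) ∧ IsLinearSolution T A x₀ q z}
  zero_mem' := by
    refine ⟨fun _ => 0, fun _ => 0, fun _ => rfl, fun _ => rfl,
      isLinearSolution_iff.2 ⟨const_mem_regulated 0, fun s hs => ?_⟩⟩
    intro ε hε
    exact ⟨fun _ => 1, fun _ _ => one_pos, fun P _ => by simpa [TaggedPart.kSum] using hε⟩
  add_mem' := by
    rintro p p' ⟨z, q, hz, hq, h⟩ ⟨z', q', hz', hq', h'⟩
    rw [isLinearSolution_iff] at h h'
    refine ⟨fun t => z t + z' t, fun t => q t + q' t, fun t => by simp [hz, hz'],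
      fun t => by simp [hq, hq'],
      isLinearSolution_iff.2 ⟨add_mem_regulated h.1 h'.1, fun s hs => ?_⟩⟩
    have := (h.2 s hs).add (h'.2 s hs)
    simp only [map_add]
    rwa [show z s + z' s - (z T + z' T) - (q s + q' s) = z s - z T - q s + (z' s - z' T - q' s) by
      abel]
  smul_mem' := by
    rintro c p ⟨z, q, hz, hq, h⟩
    rw [isLinearSolution_iff] at h
    refine ⟨fun t => c • z t, fun t => c • q t, fun t => by simp [hz], fun t => by simp [hq],
      isLinearSolution_iff.2 ⟨smul_mem_regulated c h.1, fun s hs => ?_⟩⟩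
    simpa only [map_smul, smul_sub] using (h.2 s hs).const_smul c

theorem linearRelation_single_valued (q : lp (fun _ : Icc (0 : ℝ) T => Rn n) ⊤)
    (hq : (0, q) ∈ linearRelation T A x₀) : q = 0 := by
  obtain ⟨z, q', hz, hq', h⟩ := hq
  rw [isLinearSolution_iff] at h
  have hz0 : ∀ t ∈ Icc 0 T, z t = 0 := fun t ht => by simpa using hz ⟨t, ht⟩
  ext1
  funext s
  have hT : (0 : ℝ) ≤ T := s.2.1.trans s.2.2
  have := (h.2 s s.2).norm_le (g := fun _ => 0) s.2.1 fun τ hτ r hr t ht hrt => by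
    rw [hz0 τ ⟨hτ.1, hτ.2.trans s.2.2⟩]
    simp
  rw [hz0 s s.2, hz0 T ⟨hT, le_rfl⟩, hq' s] at this
  simpa using this

/-- For a pair of the relation, `z - q` is `z(T)` plus the indefinite integral. Its increments are
dominated by those of `n * h` whenever `‖z‖ ≤ 1`, whatever `q` is, so `exists_uniform_limit`
applies. -/
theorem linearRelation_compact (hT : 0 ≤ T) {h : ℝ → ℝ} (hh : MonotoneOn h (Icc 0 T))
    (hA : ∀ τ ∈ Icc 0 T, ∀ s ∈ Icc 0 T, ∀ t ∈ Icc 0 T, s ≤ t →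
      ‖A (x₀ τ) t - A (x₀ τ) s‖ ≤ h t - h s)
    (v q : ℕ → lp (fun _ : Icc (0 : ℝ) T => Rn n) ⊤)
    (hS : ∀ k, (v k, q k) ∈ linearRelation T A x₀) (hv : ∀ k, ‖v k‖ ≤ 1) :
    ∃ j k, j < k ∧ ‖(v k - q k) - (v j - q j)‖ < 1 / 2 := by
  choose z p hz hp hsol using hS
  simp only [isLinearSolution_iff] at hsol
  have hz1 : ∀ k, ∀ t ∈ Icc 0 T, ‖z k t‖ ≤ 1 := fun k t ht => by
    rw [hz k ⟨t, ht⟩]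
    exact (lp.norm_apply_le_norm ENNReal.top_ne_zero _ _).trans (hv k)
  have hinc := fun k => norm_linear_increment_le hA (hz1 k)
  have hres : ∀ {t}, t ∈ Icc 0 T → Icc 0 t ⊆ Icc 0 T := fun ht => Icc_subset_Icc_right ht.2
  have hw : ∀ k, ∀ s ∈ Icc 0 T, ∀ t ∈ Icc 0 T, s ≤ t →
      ‖(z k t - p k t) - (z k s - p k s)‖ ≤ n * 1 * h t - n * 1 * h s := by
    intro k s hs t ht hst
    have := ((hsol k).2 s hs).norm_sub_le hs.1 hst ((hsol k).2 t ht)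
      fun τ hτ a ha b hb => hinc k τ (hres ht hτ) a (hres ht ha) b (hres ht hb)
    rwa [show z k t - z k T - p k t - (z k s - z k T - p k s)
      = (z k t - p k t) - (z k s - p k s) by abel] at this
  have hwC : ∀ k, ∀ t ∈ Icc 0 T, ‖z k t - p k t‖ ≤ n * 1 * h T - n * 1 * h 0 + 1 := by
    intro k t ht
    have h1 := ((hsol k).2 t ht).norm_le ht.1
      fun τ hτ a ha b hb => hinc k τ (hres ht hτ) a (hres ht ha) b (hres ht hb)
    have h2 := hz1 k T ⟨hT, le_rfl⟩
    have h3 : (n : ℝ) * 1 * h t ≤ n * 1 * h T :=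
      mul_le_mul_of_nonneg_left (hh ht ⟨hT, le_rfl⟩ ht.2) (by positivity)
    rw [show z k t - p k t = (z k t - z k T - p k t) + z k T by abel]
    linarith [norm_add_le (z k t - z k T - p k t) (z k T)]
  obtain ⟨y, -, hy⟩ := exists_uniform_limit (hyperfilter ℕ) hT
    (g := fun t => n * 1 * h t) (f := fun k t => z k t - p k t)
    (fun s hs t ht hst => mul_le_mul_of_nonneg_left (hh hs ht hst) (by positivity))
    (Eventually.of_forall hw) (Eventually.of_forall hwC)
  -- Two terms within `1 / 8` of the limit differ by at most `1 / 4`; the ultrafilter is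
  -- nonprincipal, so the second can be taken later.
  have hev := hy (1 / 8) (by norm_num)
  obtain ⟨j, hj⟩ := hev.exists
  obtain ⟨k, hk, hjk⟩ := (hev.and (Nat.hyperfilter_le_atTop (eventually_gt_atTop j))).exists
  refine ⟨j, k, hjk, lt_of_le_of_lt (b := (1 / 4 : ℝ))
    (lp.norm_le_of_forall_le (by norm_num) fun t => ?_) (by norm_num)⟩
  have h1 := hj t t.2
  have h2 := hk t t.2
  have h3 : ((v k - q k) - (v j - q j) : lp (fun _ : Icc (0 : ℝ) T => Rn n) ⊤) t
      = (z k t - p k t - y t) - (z j t - p j t - y t) := by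
    simp [hz, hp]
  rw [h3]
  linarith [norm_sub_le (z k t - p k t - y t) (z j t - p j t - y t)]

/-- If the homogeneous linear equation has a nontrivial solution, then the inhomogeneous one is not
always solvable. -/
theorem exists_not_isLinearSolution (hT : 0 ≤ T) {h : ℝ → ℝ} (hh : MonotoneOn h (Icc 0 T))
    (hA : ∀ τ ∈ Icc 0 T, ∀ s ∈ Icc 0 T, ∀ t ∈ Icc 0 T, s ≤ t →
      ‖A (x₀ τ) t - A (x₀ τ) s‖ ≤ h t - h s)
    {z : ℝ → Rn n} (hz : IsLinearSolution T A x₀ (fun _ => 0) z)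
    (hz0 : ∃ t ∈ Icc 0 T, z t ≠ 0) :
    ∃ q ∈ regulated 0 T (Rn n), ¬ ∃ z, IsLinearSolution T A x₀ q z := by
  by_contra! hall
  choose! sol hsol using hall
  -- The Jordan chain starts at `z`. It is iterated inside the regulated functions, as `sol` is
  -- specified only there.
  let e : ℕ → regulated 0 T (Rn n) := fun k =>
    (fun q : regulated 0 T (Rn n) => (⟨sol q, (hsol q q.2).1⟩ : regulated 0 T (Rn n)))^[k]
      ⟨z, hz.1⟩
  have he : ∀ k, IsLinearSolution T A x₀ (e k) (e (k + 1)) := fun k => by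
    simp only [e, Function.iterate_succ_apply']
    exact hsol _ (Subtype.property _)
  have hmem : ∀ k, Memℓp (fun t : Icc (0 : ℝ) T => (e k : ℝ → Rn n) t) ⊤ := fun k => by
    obtain ⟨C, hC⟩ := exists_norm_le_of_mem_regulated (e k).2
    exact memℓp_infty ⟨C, by rintro _ ⟨t, rfl⟩; exact hC t t.2⟩
  refine not_exists_jordan_chain (linearRelation T A x₀) linearRelation_single_valued
    (linearRelation_compact hT hh hA) (fun k => ⟨_, hmem k⟩) ?_ ?_ ?_
  · intro h0
    obtain ⟨t, ht, hzt⟩ := hz0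
    exact hzt (congrFun (congrArg Subtype.val h0) ⟨t, ht⟩)
  · exact ⟨z, fun _ => 0, fun _ => rfl, fun _ => rfl, hz⟩
  · exact fun k => ⟨e (k + 1), e k, fun _ => rfl, fun _ => rfl, he k⟩

end Linear

/-! ### Linearization at a bifurcation point -/

section Bifurcation

variable {n : ℕ} {T : ℝ} {Λ : Set ℝ} {Ω : Set (Rn n)} {F : ℝ → Rn n → ℝ → Rn n}
  {DF : ℝ → Rn n → ℝ → Matrix (Fin n) (Fin n) ℝ} {x₀ : ℝ → Rn n} {ρ : ℝ}

/-- Translating `x₀` by the constant `y - x₀ τ` stays in `regBall`. This provides the convex set in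
`Ω` needed for the mean value inequality. -/
theorem closedBall_subset_of_regBall (hρ : 0 ≤ ρ) (hx₀ : x₀ ∈ regulated 0 T (Rn n))
    (hball : ∀ x ∈ regBall T x₀ ρ, ∀ t ∈ Icc 0 T, x t ∈ Ω) {τ : ℝ} (hτ : τ ∈ Icc 0 T) :
    Metric.closedBall (x₀ τ) ρ ⊆ Ω := by
  intro y hy
  have hmem : (fun t => x₀ t + (y - x₀ τ)) ∈ regBall T x₀ ρ := by
    refine ⟨add_mem_regulated hx₀ (const_mem_regulated _), Real.iSup_le (fun t => ?_) hρ⟩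
    simpa [dist_eq_norm] using hy
  simpa using hball _ hmem τ hτ

/-- The first-order expansion of the increments of `F(λ, ·, t)` near `x`, with the derivative taken
at a nearby parameter `μ`. -/
theorem norm_increment_sub_linear_le {h ω γ : ℝ → ℝ} (hh : MonotoneOn h (Icc 0 T))
    (hγ : MonotoneOn γ (Icc 0 T)) (hω : StrictMonoOn ω (Ici 0))
    {lam μ ε r : ℝ} {x y : Rn n} (hr : 0 ≤ r) (hxr : Metric.closedBall x r ⊆ Ω)
    (hder : ∀ y ∈ Ω, ∀ t ∈ Icc 0 T, HasFDerivAt (fun y => F lam y t) (matCLM (DF lam y t)) y)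
    (hDF : DF lam ∈ classF Ω 0 T h ω)
    (hpar : ∀ t ∈ Icc 0 T, ∀ s ∈ Icc 0 T,
      ‖DF lam x t - DF μ x t - DF lam x s + DF μ x s‖ ≤ ε * |γ t - γ s|)
    (hy : ‖y - x‖ ≤ r) {s t : ℝ} (hs : s ∈ Icc 0 T) (ht : t ∈ Icc 0 T) (hst : s ≤ t) :
    ‖(F lam y t - F lam y s) - (F lam x t - F lam x s) - matCLM (DF μ x t - DF μ x s) (y - x)‖ ≤
      n * (ω r * (h t - h s) + ε * (γ t - γ s)) * ‖y - x‖ := by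
  have hh' : 0 ≤ h t - h s := sub_nonneg.2 (hh hs ht hst)
  have hγ' : 0 ≤ γ t - γ s := sub_nonneg.2 (hγ hs ht hst)
  have hxΩ : x ∈ Ω := hxr (Metric.mem_closedBall_self hr)
  refine (convex_closedBall x r).norm_image_sub_le_of_norm_hasFDerivWithin_le'
    (f := fun y => F lam y t - F lam y s)
    (f' := fun y => matCLM (DF lam y t) - matCLM (DF lam y s))
    (fun w hw => ((hder w (hxr hw) t ht).sub (hder w (hxr hw) s hs)).hasFDerivWithinAt)
    (fun w hw => ?_) (Metric.mem_closedBall_self hr) (by simpa [dist_eq_norm] using hy)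
  rw [← matCLM_sub, ← matCLM_sub]
  refine (norm_matCLM_le _).trans (mul_le_mul_of_nonneg_left ?_ n.cast_nonneg)
  have hwr : ‖w - x‖ ≤ r := by simpa [dist_eq_norm] using hw
  have h1 := hDF.2 w (hxr hw) x hxΩ s hs t ht
  have h2 := hpar t ht s hs
  rw [abs_of_nonneg hh'] at h1
  rw [abs_of_nonneg hγ'] at h2
  have h3 : ω ‖w - x‖ * (h t - h s) ≤ ω r * (h t - h s) :=
    mul_le_mul_of_nonneg_right (hω.monotoneOn (norm_nonneg _) hr hwr) hh'
  -- The derivative error splits into a change of the point, controlled by `ω`, and a change of the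
  -- parameter, controlled by `γ`.
  rw [show DF lam w t - DF lam w s - (DF μ x t - DF μ x s)
    = (DF lam w t - DF lam w s - DF lam x t + DF lam x s)
      + (DF lam x t - DF μ x t - DF lam x s + DF μ x s) by abel]
  linarith [norm_add_le (DF lam w t - DF lam w s - DF lam x t + DF lam x s)
    (DF lam x t - DF μ x t - DF lam x s + DF μ x s)]

/-- Both equations hold at the same `lam`, and periodicity puts `x₀ T` in place of `x₀ 0`. -/
theorem hasKurzweilIntegral_sub_of_isOperatorSolution {x : ℝ → Rn n} {lam : ℝ}
    (hx₀ : IsPeriodicSolution Λ Ω T F x₀ lam) (hx : IsOperatorSolution Λ T F x₀ ρ x lam) {s : ℝ}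
    (hs : s ∈ Icc 0 T) :
    HasKurzweilIntegral (fun τ t => F lam (x τ) t - F lam (x₀ τ) t) 0 s
      ((x s - x₀ s) - (x T - x₀ T)) := by
  obtain ⟨h1, h2⟩ := hx.2.2 s hs
  obtain ⟨-, h3, h4⟩ := hx₀.2.2.1 s hs
  have := h1.hasKurzweilIntegral.sub h3.hasKurzweilIntegral
  rw [Phi] at h2
  rw [hx₀.2.2.2] at h4
  rwa [show (x s - x₀ s) - (x T - x₀ T) = kurzweilIntegral (fun τ t => F lam (x τ) t) 0 s
    - kurzweilIntegral (fun τ t => F lam (x₀ τ) t) 0 s by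
      rw [sub_sub_sub_comm, sub_eq_of_eq_add' h2, sub_eq_of_eq_add' h4]]

/-- At a bifurcation point the linearized homogeneous equation has a nontrivial solution. -/
theorem IsBifurcationPoint.exists_isLinearSolution (hT : 0 < T) (hρ : 0 < ρ)
    (hx₀ : ∀ lam ∈ Λ, IsPeriodicSolution Λ Ω T F x₀ lam)
    (hball : ∀ x ∈ regBall T x₀ ρ, ∀ t ∈ Icc 0 T, x t ∈ Ω)
    (hDF : DerivCondition Λ Ω T F DF) (hDFparam : ParamCondition Λ Ω T DF)
    {lam₀ : ℝ} (hlam₀ : lam₀ ∈ Λ) (hbif : IsBifurcationPoint Λ T F ρ x₀ lam₀) :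
    ∃ z, IsLinearSolution T (DF lam₀) x₀ (fun _ => 0) z ∧ ∃ t ∈ Icc 0 T, z t ≠ 0 := by
  obtain ⟨hder, -, h, ω, hh, -, ⟨hω, hωc, hω0⟩, hcl⟩ := hDF
  obtain ⟨γ, hγ, hpar⟩ := hDFparam
  have hreg := (hx₀ lam₀ hlam₀).1
  have hTT : T ∈ Icc 0 T := ⟨hT.le, le_rfl⟩
  choose x lam hsol hsup hlam hne using fun k : ℕ => hbif.2 (1 / ((k : ℝ) + 1)) (by positivity)
  set m : ℕ → ℝ := fun k => supNorm T fun t => x k t - x₀ t with hm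
  have hle : ∀ k, ∀ t ∈ Icc 0 T, ‖x k t - x₀ t‖ ≤ m k := fun k t ht =>
    norm_le_supNorm (sub_mem_regulated (hsol k).1.1 hreg) ht
  have hmpos : ∀ k, 0 < m k := fun k => by
    obtain ⟨t, ht, hxt⟩ := hne k
    exact (norm_pos_iff.2 (sub_ne_zero.2 hxt)).trans_le (hle k t ht)
  have hm0 : Tendsto m atTop (𝓝 0) := squeeze_zero (fun k => (hmpos k).le)
    (fun k => (hsup k).le) tendsto_one_div_add_atTop_nhds_zero_nat
  have hlam' : Tendsto (fun k => |lam k - lam₀|) atTop (𝓝 0) := squeeze_zero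
    (fun k => abs_nonneg _) (fun k => (hlam k).le) tendsto_one_div_add_atTop_nhds_zero_nat
  have hωm : Tendsto (fun k => ω (m k)) atTop (𝓝 0) := by
    have h1 : Tendsto ω (𝓝[Ici 0] 0) (𝓝 0) := by simpa [hω0] using (hωc 0 self_mem_Ici).tendsto
    exact h1.comp (tendsto_nhdsWithin_iff.2
      ⟨hm0, Eventually.of_forall fun k => (hmpos k).le⟩)
  set Z : ℕ → ℝ → Rn n := fun k t => (m k)⁻¹ • (x k t - x₀ t) with hZ
  set W : ℕ → ℝ → ℝ → Rn n := fun k τ t =>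
    (m k)⁻¹ • (F (lam k) (x k τ) t - F (lam k) (x₀ τ) t) with hW
  have hint : ∀ k, ∀ s ∈ Icc 0 T, HasKurzweilIntegral (W k) 0 s (Z k s - Z k T) := by
    intro k s hs
    simpa only [hZ, ← smul_sub] using (hasKurzweilIntegral_sub_of_isOperatorSolution
      (hx₀ (lam k) (hsol k).2.1) (hsol k) hs).const_smul (m k)⁻¹
  have hZ1 : ∀ k, ∀ t ∈ Icc 0 T, ‖Z k t‖ ≤ 1 := by
    intro k t ht
    rw [hZ, norm_smul, norm_inv, Real.norm_of_nonneg (hmpos k).le, inv_mul_le_iff₀ (hmpos k),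
      mul_one]
    exact hle k t ht
  set g : ℝ → ℝ := fun t => h t + γ t with hg
  have hgm : MonotoneOn g (Icc 0 T) := hh.add hγ
  have hhg : ∀ s ∈ Icc 0 T, ∀ t ∈ Icc 0 T, s ≤ t → h t - h s ≤ g t - g s := by
    intro s hs t ht hst
    have := hγ hs ht hst
    simp only [hg]
    linarith
  have hA : ∀ τ ∈ Icc 0 T, ∀ s ∈ Icc 0 T, ∀ t ∈ Icc 0 T, s ≤ t →
      ‖DF lam₀ (x₀ τ) t - DF lam₀ (x₀ τ) s‖ ≤ g t - g s := by
    intro τ hτ s hs t ht hst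
    have := (hcl lam₀ hlam₀).1 _ ((hx₀ lam₀ hlam₀).2.2.1 τ hτ).1 s hs t ht
    rw [abs_of_nonneg (sub_nonneg.2 (hh hs ht hst))] at this
    exact this.trans (hhg s hs t ht hst)
  -- The heart of the linearization: the estimate is uniform in `τ`, `s` and `t`, because `ω (m k)`
  -- and `|lam k - lam₀|` tend to `0`.
  have hest : ∀ ε > 0, ∀ᶠ k in atTop, ∀ τ ∈ Icc 0 T, ∀ s ∈ Icc 0 T, ∀ t ∈ Icc 0 T, s ≤ t →
      ‖(W k τ t - W k τ s) - matCLM (DF lam₀ (x₀ τ) t - DF lam₀ (x₀ τ) s) (Z k τ)‖ ≤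
        ε * (g t - g s) := by
    intro ε hε
    set η := ε / ((n : ℝ) + 1) with hη
    have hη0 : 0 < η := by positivity
    have hnη : n * η ≤ ε := by
      rw [hη, mul_div_assoc', div_le_iff₀ (by positivity)]
      nlinarith
    obtain ⟨δ, hδ, hδpar⟩ := hpar η hη0
    filter_upwards [hωm.eventually (gt_mem_nhds hη0), hm0.eventually (gt_mem_nhds hρ),
      hlam'.eventually (gt_mem_nhds hδ)] with k h1 h2 h3 τ hτ s hs t ht hst
    have hxΩ := ((hx₀ lam₀ hlam₀).2.2.1 τ hτ).1
    have key := norm_increment_sub_linear_le (F := F) (μ := lam₀) (y := x k τ) hh hγ hω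
      (hmpos k).le ((Metric.closedBall_subset_closedBall h2.le).trans
        (closedBall_subset_of_regBall hρ.le hreg hball hτ))
      (hder (lam k) (hsol k).2.1) (hcl (lam k) (hsol k).2.1)
      (fun t ht s hs => hδpar (x₀ τ) hxΩ t ht s hs (lam k) (hsol k).2.1 lam₀ hlam₀ h3)
      (hle k τ hτ) hs ht hst
    have hh' : 0 ≤ h t - h s := sub_nonneg.2 (hh hs ht hst)
    have hg' : 0 ≤ g t - g s := sub_nonneg.2 (hgm hs ht hst)
    have hb : ω (m k) * (h t - h s) + η * (γ t - γ s) ≤ η * (g t - g s) := by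
      have := mul_le_mul_of_nonneg_right h1.le hh'
      simp only [hg]
      linarith
    have heq : (W k τ t - W k τ s) - matCLM (DF lam₀ (x₀ τ) t - DF lam₀ (x₀ τ) s) (Z k τ) =
        (m k)⁻¹ • ((F (lam k) (x k τ) t - F (lam k) (x k τ) s)
          - (F (lam k) (x₀ τ) t - F (lam k) (x₀ τ) s)
          - matCLM (DF lam₀ (x₀ τ) t - DF lam₀ (x₀ τ) s) (x k τ - x₀ τ)) := by
      simp only [hW, hZ, map_smul, ← smul_sub]
      rw [sub_sub_sub_comm]
    rw [heq, norm_smul, norm_inv, Real.norm_of_nonneg (hmpos k).le, inv_mul_le_iff₀ (hmpos k)]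
    calc _ ≤ _ := key
      _ ≤ n * (η * (g t - g s)) * m k := by
        gcongr
        exact hle k τ hτ
      _ ≤ m k * (ε * (g t - g s)) := by
        have := mul_le_mul_of_nonneg_right hnη (mul_nonneg hg' (hmpos k).le)
        linarith
  have hlin : ∀ τ ∈ Icc 0 T, ∀ s ∈ Icc 0 T, ∀ t ∈ Icc 0 T, s ≤ t → ∀ v : Rn n,
      ‖matCLM (DF lam₀ (x₀ τ) t - DF lam₀ (x₀ τ) s) v‖ ≤ n * (g t - g s) * ‖v‖ := by
    intro τ hτ s hs t ht hst v
    refine (norm_matCLM_apply_le _ _).trans ?_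
    gcongr
    exact hA τ hτ s hs t ht hst
  have hres : ∀ {t}, t ∈ Icc 0 T → Icc 0 t ⊆ Icc 0 T := fun ht => Icc_subset_Icc_right ht.2
  -- In the factor `n + 1`, `n` comes from the linear part with `‖Z k τ‖ ≤ 1` and `1` from `hest`
  -- with `ε = 1`.
  have hZinc : ∀ᶠ k in (hyperfilter ℕ : Filter ℕ), ∀ s ∈ Icc 0 T, ∀ t ∈ Icc 0 T, s ≤ t →
      ‖Z k t - Z k s‖ ≤ (n + 1) * g t - (n + 1) * g s := by
    filter_upwards [Nat.hyperfilter_le_atTop (hest 1 one_pos)] with k hk s hs t ht hst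
    rw [← sub_sub_sub_cancel_right _ _ (Z k T)]
    refine (hint k s hs).norm_sub_le (g := fun t => (n + 1) * g t) hs.1 hst (hint k t ht)
      fun τ hτ a ha b hb hab => ?_
    have h1 := hk τ (hres ht hτ) a (hres ht ha) b (hres ht hb) hab
    have h2 := hlin τ (hres ht hτ) a (hres ht ha) b (hres ht hb) hab (Z k τ)
    have h3 : 0 ≤ g b - g a := sub_nonneg.2 (hgm (hres ht ha) (hres ht hb) hab)
    have h4 : n * (g b - g a) * ‖Z k τ‖ ≤ n * (g b - g a) * 1 := by
      gcongr
      exact hZ1 k τ (hres ht hτ)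
    have h5 := norm_add_le
      (W k τ b - W k τ a - matCLM (DF lam₀ (x₀ τ) b - DF lam₀ (x₀ τ) a) (Z k τ))
      (matCLM (DF lam₀ (x₀ τ) b - DF lam₀ (x₀ τ) a) (Z k τ))
    rw [sub_add_cancel] at h5
    linarith
  have hgm' : MonotoneOn (fun t => ((n : ℝ) + 1) * g t) (Icc 0 T) := fun s hs t ht hst =>
    mul_le_mul_of_nonneg_left (hgm hs ht hst) (by positivity)
  obtain ⟨z, hzinc, hzlim⟩ := exists_uniform_limit (hyperfilter ℕ) hT.le hgm' hZinc
    (Eventually.of_forall hZ1)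
  refine ⟨z, isLinearSolution_iff.2 ⟨mem_regulated_of_norm_sub_le hT.le hgm' hzinc,
    fun s hs => ?_⟩, ?_⟩
  · refine HasKurzweilIntegral.of_approx hs.1 (hgm.mono (hres hs)) fun ε hε => ?_
    -- This gives both `2 * η ≤ ε`, for the values at `s` and `T`, and `n * η ≤ ε / 2`, for
    -- replacing `Z k` by `z` in the integrand.
    set η := ε / (2 * ((n : ℝ) + 1)) with hη
    have hη0 : 0 < η := by positivity
    have hnη : η * (2 * ((n : ℝ) + 1)) = ε := div_mul_cancel₀ _ (by positivity)
    have hn0 : 0 ≤ η * n := by positivity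
    obtain ⟨k, hk1, hk2⟩ := ((hzlim η hη0).and
      (Nat.hyperfilter_le_atTop (hest (ε / 2) (by linarith)))).exists
    refine ⟨W k, _, hint k s hs, ?_, fun τ hτ a ha b hb hab => ?_⟩
    · have h1 := hk1 s hs
      have h2 := hk1 T hTT
      rw [sub_zero, sub_sub_sub_comm]
      linarith [norm_sub_le (Z k s - z s) (Z k T - z T)]
    · have h1 := hk2 τ (hres hs hτ) a (hres hs ha) b (hres hs hb) hab
      have h2 := hlin τ (hres hs hτ) a (hres hs ha) b (hres hs hb) hab (Z k τ - z τ)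
      have h3 : 0 ≤ g b - g a := sub_nonneg.2 (hgm (hres hs ha) (hres hs hb) hab)
      have h4 : n * (g b - g a) * ‖Z k τ - z τ‖ ≤ n * (g b - g a) * η := by
        gcongr
        exact hk1 τ (hres hs hτ)
      have h5 := norm_add_le
        (W k τ b - W k τ a - matCLM (DF lam₀ (x₀ τ) b - DF lam₀ (x₀ τ) a) (Z k τ))
        (matCLM (DF lam₀ (x₀ τ) b - DF lam₀ (x₀ τ) a) (Z k τ - z τ))
      rw [map_sub, sub_add_sub_cancel] at h5
      have h6 : n * (g b - g a) * η ≤ ε / 2 * (g b - g a) := by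
        have : n * η ≤ ε / 2 := by linarith
        nlinarith
      rw [map_sub] at h2
      rw [← sub_apply, ← matCLM_sub]
      linarith
  -- At some `t` one has `‖Z k t‖ > 1 / 2`, while `Z k` is within `1 / 4` of `z`.
  · obtain ⟨k, hk⟩ := (hzlim (1 / 4) (by norm_num)).exists
    obtain ⟨t, ht⟩ : ∃ t : Icc (0 : ℝ) T, m k / 2 < ‖x k t - x₀ t‖ := by
      have : Nonempty (Icc (0 : ℝ) T) := ⟨⟨T, hTT⟩⟩
      exact exists_lt_of_lt_ciSup (show m k / 2 < m k by linarith [hmpos k])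
    refine ⟨t, t.2, fun hz0 => ?_⟩
    have h1 := hk t t.2
    rw [hz0, sub_zero, hZ, norm_smul, norm_inv, Real.norm_of_nonneg (hmpos k).le,
      inv_mul_le_iff₀ (hmpos k)] at h1
    linarith [hmpos k]

end Bifurcation

theorem mainTheorem1 {n : ℕ} (T : ℝ) (hT : 0 < T)
    (Λ : Set ℝ) (hΛ : IsOpen Λ) (Ω : Set (Rn n)) (hΩ : IsOpen Ω)
    (F : ℝ → Rn n → ℝ → Rn n) (DF : ℝ → Rn n → ℝ → Matrix (Fin n) (Fin n) ℝ)
    (x₀ : ℝ → Rn n) (ρ : ℝ) (hρ : 0 < ρ)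
    (hF : FieldCondition Λ Ω T F)
    (hx₀ : ∀ lam ∈ Λ, IsPeriodicSolution Λ Ω T F x₀ lam)
    (hball : ∀ x ∈ regBall T x₀ ρ, ∀ t ∈ Icc 0 T, x t ∈ Ω)
    (hFparam : ParamCondition Λ Ω T F)
    (hDF : DerivCondition Λ Ω T F DF)
    (hDFparam : ParamCondition Λ Ω T DF)
    (lam₀ : ℝ) (hlam₀ : lam₀ ∈ Λ)
    (hbif : IsBifurcationPoint Λ T F ρ x₀ lam₀) :
    (∃ q ∈ regulated 0 T (Rn n), ¬ ∃ z, IsLinearSolution T (DF lam₀) x₀ q z) ∧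
    (∃ z, IsLinearSolution T (DF lam₀) x₀ (fun _ => 0) z ∧ ∃ t ∈ Icc 0 T, z t ≠ 0) := by
  obtain ⟨z, hz, hz0⟩ := hbif.exists_isLinearSolution hT hρ hx₀ hball hDF hDFparam hlam₀
  refine ⟨?_, z, hz, hz0⟩
  obtain ⟨-, -, h, ω, hh, -, -, hcl⟩ := hDF
  refine exists_not_isLinearSolution hT.le hh (fun τ hτ s hs t ht hst => ?_) hz hz0
  have := (hcl lam₀ hlam₀).1 _ ((hx₀ lam₀ hlam₀).2.2.1 τ hτ).1 s hs t ht
  rwa [abs_of_nonneg (sub_nonneg.2 (hh hs ht hst))] at this
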